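/- Let $q$ be an odd prime power, let $\omega$ be a primitive element of $\mathbb F_{q^3}$, let $\psi$ be the canonical additive character of $\mathbb F_{q^3}$, and put $\psi(D)=\sum_{x\in D}\psi(x)$ for $D\subseteq\mathbb F_{q^3}$. Let $\eta$ be the quadratic character of $\mathbb F_{q^3}$ and $G_{q^3}(\eta)=\sum_{x\neq 0}\eta(x)\psi(x)$. For $K\mid q^3-1$ and $i\in\mathbb Z_K$ let $C_i^{(K)}=\omega^i\langle\omega^K\rangle$ be the cyclotomic class of order $K$. Let $M$ be a positive divisor of $q^2+q+1$, put $N=(q^2+q+1)/M$, and assume that the Gauss periods $\psi(C_i^{(N)})$, $i\in\mathbb Z_N$, take exactly the three values $\alpha_1=-M+2q$, $\alpha_2=-M+q$, $\alpha_3=-M$. Put $I_j=\{i\in\mathbb Z_N:\psi(C_i^{(N)})=\alpha_j\}$ and let $2^{-1}I_j=\{2^{-1}i: i\in I_j\}\subseteq\mathbb Z_N$ (note that $N$ is odd). Let $\mathrm{Tr}$ be the trace from $\mathbb F_{q^3}$ to $\mathbb F_q$, let $W_{\mathcal Q}=\{i\in\mathbb Z_{q^2+q+1}:\mathrm{Tr}(\omega^{2i})=0\}$,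 choose any integer representatives of the residue classes modulo $q^2+q+1$, fix $d_0\in W_{\mathcal Q}$, and define $$\mathcal X_{\mathcal Q}=\{\omega^{d}\,\mathrm{Tr}(\omega^{d_0+d}): d\in W_{\mathcal Q},\ d\ne d_0\}\cup\{2\omega^{d_0}\},\qquad X_{\mathcal Q}=\{\log_\omega x \bmod 2(q^2+q+1): x\in\mathcal X_{\mathcal Q}\}.$$ For $i=1,2$ let $X_i$ be the multiset of the residues $x \bmod 2N$ of those $x\in X_{\mathcal Q}$ with $x\bmod N\in 2^{-1}I_i$, counted with multiplicity. Suppose that $X_1$ is purely a subset of $\mathbb Z_{2N}$, that is, each element of $\mathbb Z_{2N}$ appears in $X_1$ at most once. Then for every integer $c$, $$2\,\psi\Big(\omega^c\bigcup_{\ell\in X_2}C_\ell^{(2N)}\Big)-\psi\Big(\omega^c\bigcup_{\ell\in 2^{-1}I_2}C_\ell^{(N)}\Big)=\begin{cases}\pm G_{q^3}(\eta), & \text{if } c\bmod N\in 2^{-1}I_2,\\ 0, & \text{otherwise,}\end{cases}$$ where the sign may depend on $c$. -/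

import Mathlib

noncomputable section

open scoped Pointwise

namespace ConicPartition

/-- The canonical additive character `x ↦ exp (2 π i Tr(x) / p)` of a finite field `E` of
characteristic `p`, with `Tr` the absolute trace (the `ZMod p`-algebra structure is unique). -/
def canonicalAddChar (p : ℕ) [Fact p.Prime] (E : Type*) [Field E] [Algebra (ZMod p) E] :
    AddChar E ℂ :=
  (ZMod.stdAddChar (N := p)).compAddMonoidHom (Algebra.trace (ZMod p) E).toAddMonoidHom

open Classical in
/-- `ψ(D) = ∑_{x ∈ D} ψ(x)` for a subset `D` of a finite field. -/
def charSum {E : Type*} [Field E] [Fintype E] (ψ : AddChar E ℂ) (D : Set E) : ℂ :=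
  ∑ x with x ∈ D, ψ x

/-- The quadratic Gauss sum `G(η) = ∑_{x ≠ 0} η(x) ψ(x)`, with `η` the quadratic character. -/
def quadraticGaussSum {E : Type*} [Field E] [Fintype E] [DecidableEq E] (ψ : AddChar E ℂ) : ℂ :=
  gaussSum ((quadraticChar E).ringHomComp (Int.castRingHom ℂ)) ψ

/-- The cyclotomic class `C_i = ω ^ i ⟨ω ^ K⟩` of order `K`, that is, the set of all `ω ^ n` with
`n ≡ i (mod K)`. -/
def cyclotomicClass {E : Type*} [Field E] (ω : Eˣ) (K : ℕ) (i : ZMod K) : Set E :=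
  {x | ∃ n : ℤ, (n : ZMod K) = i ∧ x = ((ω ^ n : Eˣ) : E)}

/-- The Gauss periods of order `K`. -/
def gaussPeriod {E : Type*} [Field E] [Fintype E] (ψ : AddChar E ℂ) (ω : Eˣ) (K : ℕ)
    (i : ZMod K) : ℂ :=
  charSum ψ (cyclotomicClass ω K i)

/-- The set of indices `i` modulo `K` for which the Gauss period of `C_i` is `a`. -/
def periodIndices {E : Type*} [Field E] [Fintype E] (ψ : AddChar E ℂ) (ω : Eˣ) (K : ℕ)
    (a : ℂ) : Set (ZMod K) :=
  {i | gaussPeriod ψ ω K i = a}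

/-- `2⁻¹ I` modulo `K` (used for odd `K` only). -/
def half {K : ℕ} (I : Set (ZMod K)) : Set (ZMod K) :=
  (fun i => (2 : ZMod K)⁻¹ * i) '' I

/-- `ω ^ c ⋃_{ℓ ∈ I} C_ℓ`, with cyclotomic classes of order `K`. -/
def shiftedUnion {E : Type*} [Field E] (ω : Eˣ) (K : ℕ) (c : ℤ) (I : Set (ZMod K)) : Set E :=
  ((ω ^ c : Eˣ) : E) • ⋃ ℓ ∈ I, cyclotomicClass ω K ℓ

/-- The quadratic form `Q(x) = Tr(x²)`. -/
def conicForm (F : Type*) {E : Type*} [Field F] [Field E] [Algebra F E] (x : E) : F :=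
  Algebra.trace F E (x ^ 2)

/-- The index set `W` of the conic `Q = 0`, modulo `n` (where `n = q² + q + 1`). -/
def conicIndices (F : Type*) {E : Type*} [Field F] [Field E] [Algebra F E] (ω : Eˣ) (n : ℕ) :
    Set (ZMod n) :=
  {i | ∃ k : ℤ, (k : ZMod n) = i ∧ conicForm F ((ω ^ k : Eˣ) : E) = 0}

/-- The set `{ω ^ d Tr(ω ^ (d₀ + d)) : d ∈ W, d ≠ d₀} ∪ {2 ω ^ d₀}`, where `r` selects an integer
representative of each residue class modulo `n`. -/
def conicLift (F : Type*) {E : Type*} [Field F] [Field E] [Algebra F E] (ω : Eˣ) (n : ℕ)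
    (r : ZMod n → ℤ) (d₀ : ZMod n) : Set E :=
  {x | ∃ d ∈ conicIndices F ω n, d ≠ d₀ ∧
      x = ((ω ^ r d : Eˣ) : E) *
        algebraMap F E (Algebra.trace F E ((ω ^ (r d₀ + r d) : Eˣ) : E))} ∪
    {2 * ((ω ^ r d₀ : Eˣ) : E)}

/-- The set of discrete logarithms modulo `2 n` of the elements of `conicLift`. -/
def conicPartitionSet (F : Type*) {E : Type*} [Field F] [Field E] [Algebra F E] (ω : Eˣ) (n : ℕ)
    (r : ZMod n → ℤ) (d₀ : ZMod n) : Set (ZMod (2 * n)) :=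
  {i | ∃ k : ℤ, (k : ZMod (2 * n)) = i ∧ ((ω ^ k : Eˣ) : E) ∈ conicLift F ω n r d₀}

open Classical in
/-- The multiset of the residues modulo `2 N` of those `x ∈ X` whose residue modulo `N` lies in
`J`, counted with multiplicity (where `N ∣ n`). -/
def reducedPart {n : ℕ} [NeZero n] (N : ℕ) (X : Set (ZMod (2 * n))) (J : Set (ZMod N)) :
    Multiset (ZMod (2 * N)) :=
  (Finset.univ.filter fun x : ZMod (2 * n) => x ∈ X ∧ (x.cast : ZMod N) ∈ J).val.map
    fun x => (x.cast : ZMod (2 * N))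

/-- A multiset is purely a set if each element appears in it at most once. -/
def IsPurelySet {α : Type*} [DecidableEq α] (X : Multiset α) : Prop :=
  ∀ a, X.count a ≤ 1

end ConicPartition

end

/-! Put n = q² + q + 1 and x = ω ^ r d₀. The factor Tr(ω ^ (d₀ + d)) normalises each point of the
conic Tr(v²) = 0: rescaling ω ^ d by l in F changes the product by l². So X_Q records, modulo 2n,
the half of the isotropic cone made of the square multiples of chosen representatives P. The
associated signed function f = `conicSign` satisfies f(l • P) = η_F(l) and vanishes off the cone.

The heart is `sum_conicSign_addChar`: f is an eigenfunction of the Fourier transform. In a basis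
where Tr(v²) is 2ab - c², the conic is a parabola in t with one point at infinity; completing the
square in t leaves quadratic Gauss sums over F, and the point at infinity absorbs the error term.
The eigenvalue is κ = q η_F(2) G_q(η_F), and `gaussSum_cubic_sq` gives κ = ± G_{q³}(η).

Summing f over the multipliers ω ^ (2Nj), 0 ≤ j < M, preserves the eigenvalue equation
(`sum_translates`). The sum has value 2 a(k) - w(k) at ω ^ k, where a and w count the translates ω ^
(k + 2Nj) in the half cone and in the whole cone. By `gaussPeriod_eq` the period at 2k is q w(k) -
M, so w is 2, 1, 0 on the halves of I₁, I₂, I₃. Since a(k) + a(k + N) = w(k), purity forces a = 1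
where w = 2, so the summed function vanishes there; it also vanishes where w = 0 and is ±1 where w =
1. It is therefore 2·1_{X₂} - 1_{2⁻¹I₂}, and its transform at ω ^ c, which is the left-hand side,
equals κ times its value at c. -/

namespace ConicPartition

/-! ### Quadratic character and Gauss sums over the base field. -/

section QuadraticSums

variable {F : Type*} [Field F] [Fintype F] [DecidableEq F]

/-- The quadratic character with complex values. -/
def complexQuadraticChar (F : Type*) [Field F] [Fintype F] [DecidableEq F] : MulChar F ℂ :=
  (quadraticChar F).ringHomComp (Int.castRingHom ℂ)

theorem complexQuadraticChar_apply (a : F) :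
    complexQuadraticChar F a = ((quadraticChar F a : ℤ) : ℂ) := rfl

theorem complexQuadraticChar_ne_one (hF : ringChar F ≠ 2) : complexQuadraticChar F ≠ 1 := by
  obtain ⟨a, ha⟩ := quadraticChar_exists_neg_one' hF
  intro h
  have h1 : complexQuadraticChar F a = 1 := by rw [h, MulChar.one_apply_coe]
  rw [complexQuadraticChar_apply, ha] at h1
  norm_num at h1

theorem complexQuadraticChar_isQuadratic : (complexQuadraticChar F).IsQuadratic :=
  (quadraticChar_isQuadratic F).comp _

theorem complexQuadraticChar_mul_self {a : F} (ha : a ≠ 0) :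
    complexQuadraticChar F a * complexQuadraticChar F a = 1 := by
  rw [complexQuadraticChar_apply, ← Int.cast_mul, ← sq, quadraticChar_sq_one ha, Int.cast_one]

theorem complexQuadraticChar_div (a b : F) :
    complexQuadraticChar F (a / b) = complexQuadraticChar F (a * b) := by
  by_cases hb : b = 0
  · simp [hb]
  · have h : a * b = a / b * (b * b) := by field_simp
    rw [h, map_mul _ (a / b), map_mul _ b, complexQuadraticChar_mul_self hb, mul_one]

/-- Including a = 0, where both sides vanish, spares case distinctions in later sums. -/
theorem sum_complexQuadraticChar_mul (ψ : AddChar F ℂ) (hF : ringChar F ≠ 2) (a : F) :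
    ∑ x, complexQuadraticChar F x * ψ (x * a) =
      complexQuadraticChar F a * gaussSum (complexQuadraticChar F) ψ := by
  by_cases ha : a = 0
  · simpa [ha, MulChar.map_zero] using
      MulChar.sum_eq_zero_of_ne_one (complexQuadraticChar_ne_one hF)
  · have h := gaussSum_mulShift_eq (complexQuadraticChar F) ψ (Units.mk0 a ha)
    rw [complexQuadraticChar_isQuadratic.inv] at h
    rw [Units.val_mk0] at h
    rw [← h, gaussSum]
    simp [mul_comm]

theorem sum_addChar_mul {ψ : AddChar F ℂ} (hψ : ψ.IsPrimitive) (a : F) :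
    ∑ x, ψ (x * a) = if a = 0 then (Fintype.card F : ℂ) else 0 :=
  (AddChar.sum_mulShift a hψ).trans (by split_ifs <;> simp)

theorem sum_addChar_sq {ψ : AddChar F ℂ} (hψ : ψ.IsPrimitive) (hF : ringChar F ≠ 2) {a : F}
    (ha : a ≠ 0) :
    ∑ t, ψ (a * t ^ 2) = complexQuadraticChar F a * gaussSum (complexQuadraticChar F) ψ := by
  rw [← sum_complexQuadraticChar_mul ψ hF, ← Finset.sum_fiberwise Finset.univ (fun t : F => t ^ 2)]
  -- An element j has 1 + η(j) square roots; the part without η sums to zero because a ≠ 0.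
  have h (j : F) : ∑ i with i ^ 2 = j, ψ (a * i ^ 2) =
      complexQuadraticChar F j * ψ (j * a) + ψ (j * a) := by
    have hc := quadraticChar_card_sqrts hF j
    have hc' : ((Finset.univ.filter fun i : F => i ^ 2 = j).card : ℂ) =
        complexQuadraticChar F j + 1 := by
      rw [complexQuadraticChar_apply, ← Int.cast_one, ← Int.cast_add, ← hc, Int.cast_natCast]
      congr 2
      ext; simp
    rw [Finset.sum_congr rfl (g := fun _ => ψ (j * a)), Finset.sum_const, nsmul_eq_mul, hc']
    · ring
    · intro i hi
      rw [(Finset.mem_filter.1 hi).2, mul_comm]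
  rw [Finset.sum_congr rfl fun j _ => h j, Finset.sum_add_distrib, sum_addChar_mul hψ, if_neg ha,
    add_zero]

/-- The transform of the quadratic character along the values of a completed square. -/
theorem sum_sum_addChar_quadratic {ψ : AddChar F ℂ} (hψ : ψ.IsPrimitive) (hF : ringChar F ≠ 2)
    {a : F} (ha : a ≠ 0) (b c : F) :
    ∑ x, complexQuadraticChar F x * ∑ t, ψ (x * (a * (t - b) ^ 2 + c)) =
      complexQuadraticChar F a * gaussSum (complexQuadraticChar F) ψ *
        ((if c = 0 then (Fintype.card F : ℂ) else 0) - 1) := by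
  -- For x ≠ 0 the inner sum contributes η(xa), and the outer η(x) cancels its x-dependence; the
  -- correction at x = 0 produces the final -1.
  have h (x : F) : complexQuadraticChar F x * ∑ t, ψ (x * (a * (t - b) ^ 2 + c)) =
      complexQuadraticChar F a * gaussSum (complexQuadraticChar F) ψ *
        (ψ (x * c) - if x = 0 then 1 else 0) := by
    by_cases hx : x = 0
    · simp [hx, MulChar.map_zero]
    · have h1 (t : F) : ψ (x * (a * (t - b) ^ 2 + c)) = ψ (x * c) * ψ (x * a * (t - b) ^ 2) := by
        rw [← AddChar.map_add_eq_mul]; ring_nf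
      simp_rw [h1]
      rw [← Finset.mul_sum, Fintype.sum_equiv (Equiv.subRight b)
        (fun t => ψ (x * a * (t - b) ^ 2)) (fun t => ψ (x * a * t ^ 2)) (fun _ => rfl), sum_addChar_sq hψ hF (mul_ne_zero hx ha),
        map_mul (complexQuadraticChar F) x a, if_neg hx]
      linear_combination complexQuadraticChar F a * gaussSum (complexQuadraticChar F) ψ *
        ψ (x * c) * complexQuadraticChar_mul_self hx
  simp_rw [h]
  rw [← Finset.mul_sum, Finset.sum_sub_distrib, sum_addChar_mul hψ]
  simp

end QuadraticSums

/-! ### Hyperbolic coordinates for the trace form. -/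

section Frame

variable (F : Type*) {E : Type*} [Field F] [Field E] [Algebra F E]

/-- `x, y, z` is a basis of `E` in which `Tr(v²)` is the form `2 a b - c²`. -/
structure HyperbolicFrame (x y z : E) : Prop where
  xx : Algebra.trace F E (x * x) = 0
  yy : Algebra.trace F E (y * y) = 0
  xy : Algebra.trace F E (x * y) = 1
  xz : Algebra.trace F E (x * z) = 0
  yz : Algebra.trace F E (y * z) = 0
  zz : Algebra.trace F E (z * z) = -1
  span : ∀ v : E, ∃ a b c : F, v = a • x + b • y + c • z

theorem trace_eq_add_pow [Fintype F] [Finite E] (hE : Module.finrank F E = 3) (x : E) :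
    algebraMap F E (Algebra.trace F E x) =
      x + x ^ Fintype.card F + (x ^ Fintype.card F) ^ Fintype.card F := by
  rw [FiniteField.algebraMap_trace_eq_sum_pow, hE, Nat.card_eq_fintype_card]
  simp [Finset.sum_range_succ, ← pow_mul, sq]

/-- The polynomial X ^ q - X already has q roots in F, so it acquires no others in E. -/
theorem mem_range_algebraMap_iff_pow_card_eq [Fintype F] (x : E) :
    x ∈ Set.range (algebraMap F E) ↔ x ^ Fintype.card F = x := by
  constructor
  · rintro ⟨a, rfl⟩
    rw [← map_pow, FiniteField.pow_card]
  · intro h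
    have h1 := FiniteField.X_pow_card_sub_X_ne_zero E (Fintype.one_lt_card (α := F))
    have h2 : (Polynomial.X ^ Fintype.card F - Polynomial.X : Polynomial F).roots.map
        (algebraMap F E) = (Polynomial.X ^ Fintype.card F - Polynomial.X : Polynomial E).roots := by
      rw [Polynomial.roots_map_of_injective_of_card_eq_natDegree (algebraMap F E).injective]
      · simp
      · rw [FiniteField.roots_X_pow_card_sub_X,
          FiniteField.X_pow_card_sub_X_natDegree_eq _ (Fintype.one_lt_card (α := F))]
        rfl
    have h3 : x ∈ (Polynomial.X ^ Fintype.card F - Polynomial.X : Polynomial E).roots := by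
      rw [Polynomial.mem_roots h1]
      simp [h]
    rw [← h2] at h3
    obtain ⟨a, -, ha⟩ := Multiset.mem_map.1 h3
    exact ⟨a, ha⟩

/-- The Gram determinant of the trace form on three elements of a cubic extension is a square. -/
theorem isSquare_det_trace_mul [Fintype F] [Finite E] (hE : Module.finrank F E = 3)
    (v : Fin 3 → E) :
    IsSquare (Matrix.of fun i j => Algebra.trace F E (v i * v j)).det := by
  set q := Fintype.card F with hq
  set σ : E ≃ₐ[F] E := FiniteField.frobeniusAlgEquivOfAlgebraic F E with hσ
  have hσa (x : E) : σ x = x ^ q := rfl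
  have hc : Nat.card E = q ^ 3 := by
    rw [Module.natCard_eq_pow_finrank (K := F), hE, Nat.card_eq_fintype_card]
  have : Fintype E := Fintype.ofFinite E
  have hσ3 (x : E) : σ (σ (σ x)) = x := by
    rw [hσa, hσa, hσa, ← pow_mul, ← pow_mul]
    have h := FiniteField.pow_card x
    rw [← Nat.card_eq_fintype_card, hc] at h
    rw [show q * (q * q) = q ^ 3 by ring, h]
  set A : Matrix (Fin 3) (Fin 3) E := !![v 0, σ (v 0), σ (σ (v 0)); v 1, σ (v 1), σ (σ (v 1));
    v 2, σ (v 2), σ (σ (v 2))] with hA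
  -- Frobenius permutes the three columns cyclically, an even permutation, so the determinant lies
  -- in F.
  have hfix : σ A.det = A.det := by
    rw [hA, Matrix.det_fin_three]
    simp [hσ3]
    ring
  obtain ⟨d, hd⟩ := (mem_range_algebraMap_iff_pow_card_eq F A.det).2 hfix
  refine ⟨d, (algebraMap F E).injective ?_⟩
  have ht (x y : E) : algebraMap F E (Algebra.trace F E (x * y)) =
      x * y + σ x * σ y + σ (σ x) * σ (σ y) := by
    rw [trace_eq_add_pow F hE, ← hq, ← hσa, ← hσa, map_mul, map_mul]
  have hAA : (algebraMap F E).mapMatrix (Matrix.of fun i j => Algebra.trace F E (v i * v j)) =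
      A * A.transpose := by
    ext i j
    rw [RingHom.mapMatrix_apply, Matrix.map_apply, Matrix.of_apply, ht, Matrix.mul_apply,
      Fin.sum_univ_three]
    fin_cases i <;> fin_cases j <;> simp [hA]
  rw [RingHom.map_det, hAA, Matrix.det_mul, Matrix.det_transpose, map_mul, hd]

/-- Complete x to a hyperbolic pair and take z orthogonal to it. The Gram determinant -Tr(z²) is a
nonzero square by `isSquare_det_trace_mul`, so z can be rescaled to Tr(z²) = -1. -/
theorem exists_hyperbolicFrame [Fintype F] [Finite E] (hE : Module.finrank F E = 3)
    (h2 : (2 : F) ≠ 0) {x : E} (hx : x ≠ 0) (hxx : Algebra.trace F E (x * x) = 0) :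
    ∃ y z : E, HyperbolicFrame F x y z := by
  have : FiniteDimensional F E := Module.finite_of_finrank_pos (by omega)
  set B := Algebra.traceForm F E with hB
  have hBa (a b : E) : Algebra.trace F E (a * b) = B a b := rfl
  have hBc (a b : E) : B a b = B b a := by rw [← hBa, ← hBa, mul_comm]
  have hnd : ∀ a : E, (∀ b, B a b = 0) → a = 0 := (traceForm_nondegenerate F E).1
  obtain ⟨u, hu⟩ : ∃ u, B x u ≠ 0 := by
    by_contra! h
    exact hx (hnd x h)
  rw [hBa] at hxx
  set w := (B x u)⁻¹ • u with hw
  have hxw : B x w = 1 := by simp [hw, hu]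
  -- Subtracting this multiple of x makes y isotropic and keeps its pairing with x equal to 1.
  set y := w - (B w w / 2) • x with hy
  have hxy : B x y = 1 := by simp [hy, hxx, hxw]
  have hyy : B y y = 0 := by
    simp only [hy, map_sub, map_smul, LinearMap.sub_apply, LinearMap.smul_apply, smul_eq_mul,
      hxx, hxw, hBc w x]
    field_simp
    ring
  obtain ⟨z, hz, hz0⟩ : ∃ z ∈ LinearMap.ker ((B x).prod (B y)), z ≠ 0 := by
    rw [← Submodule.ne_bot_iff]
    refine LinearMap.ker_ne_bot_of_finrank_lt ?_
    rw [hE]; simp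
  have hz' : B x z = 0 ∧ B y z = 0 := by simpa using hz
  obtain ⟨hxz, hyz⟩ := hz'
  have hyx : B y x = 1 := by rw [hBc, hxy]
  have hzx : B z x = 0 := by rw [hBc, hxz]
  have hzy : B z y = 0 := by rw [hBc, hyz]
  have hli : LinearIndependent F ![x, y, z] := by
    rw [Fintype.linearIndependent_iff]
    intro g hg
    rw [Fin.sum_univ_three] at hg
    simp only [Matrix.cons_val] at hg
    have h0 : g 0 = 0 := by simpa [hyx, hyy, hyz] using congrArg (B y) hg
    have h1 : g 1 = 0 := by simpa [hxx, hxy, hxz] using congrArg (B x) hg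
    have h2 : g 2 = 0 := by simpa [h0, h1, hz0] using hg
    intro i
    fin_cases i <;> assumption
  have hspan (v : E) : ∃ a b c : F, v = a • x + b • y + c • z := by
    have h := hli.span_eq_top_of_card_eq_finrank' (by simp [hE])
    have hv : v ∈ Submodule.span F (Set.range ![x, y, z]) := h ▸ Submodule.mem_top
    obtain ⟨g, hg⟩ := (Submodule.mem_span_range_iff_exists_fun F).1 hv
    refine ⟨g 0, g 1, g 2, ?_⟩
    rw [← hg, Fin.sum_univ_three]
    simp
  have hzz : B z z ≠ 0 := by
    intro h
    refine hz0 (hnd z fun v => ?_)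
    obtain ⟨a, b, c, rfl⟩ := hspan v
    simp [h, hzx, hzy]
  obtain ⟨d, hd⟩ := isSquare_det_trace_mul F hE ![x, y, z]
  rw [Matrix.det_fin_three] at hd
  simp only [Matrix.of_apply, Matrix.cons_val, hBa, hxx, hyy, hxy, hyx, hxz, hyz, hzx, hzy] at hd
  have hd' : B z z = -(d * d) := by linear_combination -hd
  have hd0 : d ≠ 0 := by
    rintro rfl
    simp [hd'] at hzz
  refine ⟨y, d⁻¹ • z, hxx, hyy, hxy, ?_, ?_, ?_, fun v => ?_⟩
  · rw [hBa, map_smul, hxz, smul_zero]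
  · rw [hBa, map_smul, hyz, smul_zero]
  · rw [hBa, map_smul, map_smul, LinearMap.smul_apply, hd', smul_eq_mul, smul_eq_mul]
    field_simp
  · obtain ⟨a, b, c, rfl⟩ := hspan v
    exact ⟨a, b, c * d, by rw [smul_smul, mul_assoc, mul_inv_cancel₀ hd0, mul_one]⟩

end Frame

/-! ### The signed isotropic cone and its Fourier transform. -/

section Cone

variable {F E : Type*} [Field F] [Field E] [Algebra F E] {x y z : E}

/-- Representatives of the points of the conic `Tr(v²) = 0`. -/
noncomputable def conicPoint (x y z : E) : Option F → E
  | none => (2 : F) • x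
  | some t => y + t • z + (t ^ 2 / 2) • x

/-- The square multiples of the chosen representatives of the points of the conic. -/
def conicCone (F : Type*) [Field F] [Algebra F E] (x y z : E) : Set E :=
  {v | ∃ s : F, s ≠ 0 ∧ ∃ o : Option F, v = s ^ 2 • conicPoint x y z o}

/-- The nonzero isotropic vectors of the trace form. -/
def isotropicCone (F : Type*) (E : Type*) [Field F] [Field E] [Algebra F E] : Set E :=
  {v | v ≠ 0 ∧ Algebra.trace F E (v * v) = 0}

open Classical in
/-- The function with values `±1` on isotropic vectors that is `1` on `conicCone`. -/
noncomputable def conicSign (F : Type*) [Field F] [Algebra F E] (x y z v : E) : ℂ :=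
  2 * (if v ∈ conicCone F x y z then 1 else 0) - if v ∈ isotropicCone F E then 1 else 0

namespace HyperbolicFrame

variable (H : HyperbolicFrame F x y z)
include H

theorem trace_x_mul (a b c : F) : Algebra.trace F E (x * (a • x + b • y + c • z)) = b := by
  simp [mul_add, H.xx, H.xy, H.xz]

theorem trace_y_mul (a b c : F) : Algebra.trace F E (y * (a • x + b • y + c • z)) = a := by
  simp [mul_add, mul_comm y x, H.yy, H.xy, H.yz]

theorem trace_z_mul (a b c : F) : Algebra.trace F E (z * (a • x + b • y + c • z)) = -c := by
  simp [mul_add, mul_comm z x, mul_comm z y, H.xz, H.yz, H.zz]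

theorem trace_mul (a b c a' b' c' : F) :
    Algebra.trace F E ((a • x + b • y + c • z) * (a' • x + b' • y + c' • z)) =
      a * b' + b * a' - c * c' := by
  rw [add_mul, add_mul, smul_mul_assoc, smul_mul_assoc, smul_mul_assoc, map_add, map_add, map_smul,
    map_smul, map_smul, H.trace_x_mul, H.trace_y_mul, H.trace_z_mul]
  simp only [smul_eq_mul]
  ring

end HyperbolicFrame

theorem smul_conicPoint_some (x y z : E) (l t : F) : l • conicPoint x y z (some t) =
    (l * (t ^ 2 / 2)) • x + l • y + (l * t) • z := by
  simp only [conicPoint, smul_add, smul_smul]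
  abel

theorem smul_conicPoint_none (x y z : E) (l : F) : l • conicPoint x y z (none : Option F) =
    (l * 2) • x + (0 : F) • y + (0 : F) • z := by
  simp [conicPoint, smul_smul]

namespace HyperbolicFrame

variable (H : HyperbolicFrame F x y z)
include H

/-- Pairing with x, y, z reads off the coordinates: on affine points the y-coordinate is l and the
z-coordinate is l t. -/
theorem smul_conicPoint_inj (h2 : (2 : F) ≠ 0) {l m : F} {o o' : Option F} (hl : l ≠ 0)
    (h : l • conicPoint x y z o = m • conicPoint x y z o') : l = m ∧ o = o' := by
  have h1 := congrArg (fun v => Algebra.trace F E (x * v)) h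
  have h3 := congrArg (fun v => Algebra.trace F E (y * v)) h
  have h4 := congrArg (fun v => Algebra.trace F E (z * v)) h
  rcases o with _ | t <;> rcases o' with _ | t' <;>
    simp only [smul_conicPoint_none, smul_conicPoint_some, H.trace_x_mul, H.trace_y_mul,
      H.trace_z_mul] at h1 h3 h4
  · exact ⟨mul_right_cancel₀ h2 h3, rfl⟩
  · exact absurd h3 (by simp [← h1, hl, h2])
  · exact absurd h1 hl
  · subst h1
    exact ⟨rfl, congrArg some (mul_left_cancel₀ hl (neg_injective h4))⟩

theorem smul_conicPoint_mem_isotropicCone (h2 : (2 : F) ≠ 0) {l : F} (hl : l ≠ 0) (o : Option F) :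
    l • conicPoint x y z o ∈ isotropicCone F E := by
  refine ⟨fun h => ?_, ?_⟩
  · have := H.smul_conicPoint_inj h2 (m := 0) (o' := o) hl (by rw [h, zero_smul])
    exact hl this.1
  · rcases o with _ | t
    · rw [smul_conicPoint_none, H.trace_mul]; ring
    · rw [smul_conicPoint_some, H.trace_mul]; field_simp; ring

theorem exists_smul_conicPoint (h2 : (2 : F) ≠ 0) {v : E} (hv : v ∈ isotropicCone F E) :
    ∃ l : F, l ≠ 0 ∧ ∃ o : Option F, v = l • conicPoint x y z o := by
  obtain ⟨hv0, hvv⟩ := hv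
  obtain ⟨a, b, c, rfl⟩ := H.span v
  rw [H.trace_mul] at hvv
  by_cases hb : b = 0
  · subst hb
    have hc : c = 0 := by
      have : c * c = 0 := by linear_combination -hvv
      simpa using this
    subst hc
    refine ⟨a / 2, ?_, none, ?_⟩
    · intro ha
      have : a = 0 := by simpa [h2] using ha
      simp [this] at hv0
    · rw [smul_conicPoint_none, div_mul_cancel₀ _ h2]
  · refine ⟨b, hb, some (c / b), ?_⟩
    rw [smul_conicPoint_some]
    congr 3
    · field_simp
      linear_combination hvv
    · field_simp

theorem smul_conicPoint_mem_conicCone (h2 : (2 : F) ≠ 0) {l : F} (hl : l ≠ 0) (o : Option F) :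
    l • conicPoint x y z o ∈ conicCone F x y z ↔ IsSquare l := by
  constructor
  · rintro ⟨s, -, o', h⟩
    exact ⟨s, by rw [← sq]; exact (H.smul_conicPoint_inj h2 hl h).1⟩
  · rintro ⟨s, rfl⟩
    exact ⟨s, by rintro rfl; simp at hl, o, by rw [sq]⟩

theorem conicCone_subset (h2 : (2 : F) ≠ 0) : conicCone F x y z ⊆ isotropicCone F E := by
  rintro v ⟨s, hs, o, rfl⟩
  exact H.smul_conicPoint_mem_isotropicCone h2 (pow_ne_zero 2 hs) o

theorem conicSign_of_notMem (h2 : (2 : F) ≠ 0) {v : E} (hv : v ∉ isotropicCone F E) :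
    conicSign F x y z v = 0 := by
  rw [conicSign, if_neg hv, if_neg fun h => hv (H.conicCone_subset h2 h)]
  simp

variable [Fintype F] [DecidableEq F]

theorem conicSign_smul_conicPoint (h2 : (2 : F) ≠ 0) (l : F) (o : Option F) :
    conicSign F x y z (l • conicPoint x y z o) = complexQuadraticChar F l := by
  by_cases hl : l = 0
  · subst hl
    rw [zero_smul, H.conicSign_of_notMem h2 (fun h => h.1 rfl), MulChar.map_zero]
  · rw [conicSign, if_pos (H.smul_conicPoint_mem_isotropicCone h2 hl o),
      complexQuadraticChar_apply]
    by_cases hs : IsSquare l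
    · rw [if_pos ((H.smul_conicPoint_mem_conicCone h2 hl o).2 hs),
        (quadraticChar_one_iff_isSquare hl).2 hs]
      norm_num
    · rw [if_neg fun h => hs ((H.smul_conicPoint_mem_conicCone h2 hl o).1 h),
        quadraticChar_neg_one_iff_not_isSquare.2 hs]
      norm_num

theorem sum_conicSign_mul [Fintype E] (h2 : (2 : F) ≠ 0) (g : E → ℂ) :
    ∑ v, conicSign F x y z v * g v =
      ∑ l : F, complexQuadraticChar F l * (g (l • conicPoint x y z (none : Option F)) +
        ∑ t : F, g (l • conicPoint x y z (some t))) := by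
  have h1 (l : F) : complexQuadraticChar F l * (g (l • conicPoint x y z (none : Option F)) +
        ∑ t : F, g (l • conicPoint x y z (some t))) =
      ∑ o : Option F, complexQuadraticChar F l * g (l • conicPoint x y z o) := by
    rw [Fintype.sum_option, mul_add, Finset.mul_sum]
  simp_rw [h1]
  rw [← Fintype.sum_prod_type' (fun (l : F) (o : Option F) =>
      complexQuadraticChar F l * g (l • conicPoint x y z o)),
    -- Only after discarding l = 0, where η vanishes, does (l, o) parametrise the cone injectively.
    ← Finset.sum_filter_of_ne (p := fun lo : F × Option F => lo.1 ≠ 0)]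
  · symm
    refine Finset.sum_of_injOn (fun lo : F × Option F => lo.1 • conicPoint x y z lo.2) ?_ ?_ ?_ ?_
    · rintro ⟨l, o⟩ hl ⟨m, o'⟩ - h
      obtain ⟨rfl, rfl⟩ := H.smul_conicPoint_inj h2 (Finset.mem_filter.1 hl).2 h
      rfl
    · intro _ _
      simp
    · intro v _ hv
      rw [H.conicSign_of_notMem h2, zero_mul]
      intro hvi
      obtain ⟨l, hl, o, rfl⟩ := H.exists_smul_conicPoint h2 hvi
      exact hv ⟨(l, o), by simp [hl], rfl⟩
    · rintro ⟨l, o⟩ -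
      rw [H.conicSign_smul_conicPoint h2]
  · rintro ⟨l, o⟩ - hl h
    simp only at h
    simp [h, MulChar.map_zero] at hl

/-- `conicSign` is an eigenfunction of the Fourier transform. -/
theorem sum_conicSign_addChar [Fintype E] (h2 : (2 : F) ≠ 0) (hF : ringChar F ≠ 2)
    {χ : AddChar F ℂ} (hχ : χ.IsPrimitive) (v : E) :
    ∑ u, conicSign F x y z u * χ (Algebra.trace F E (v * u)) =
      Fintype.card F * complexQuadraticChar F 2 * gaussSum (complexQuadraticChar F) χ *
        conicSign F x y z v := by
  rw [H.sum_conicSign_mul h2]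
  simp_rw [mul_add]
  rw [Finset.sum_add_distrib]
  obtain ⟨a, b, c, rfl⟩ := H.span v
  have e1 (l : F) : Algebra.trace F E ((a • x + b • y + c • z) *
      l • conicPoint x y z (none : Option F)) = l * (b * 2) := by
    rw [smul_conicPoint_none, H.trace_mul]; ring
  have e2 (l t : F) : Algebra.trace F E ((a • x + b • y + c • z) *
      l • conicPoint x y z (some t)) = l * (a + b * t ^ 2 / 2 - c * t) := by
    rw [smul_conicPoint_some, H.trace_mul]; ring
  simp_rw [e1, e2]
  rw [sum_complexQuadraticChar_mul χ hF]
  by_cases hb : b = 0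
  · subst hb
    by_cases hc : c = 0
    · subst hc
      have hs : a • x + (0 : F) • y + (0 : F) • z = (a / 2) • conicPoint x y z (none : Option F) := by
        rw [smul_conicPoint_none, div_mul_cancel₀ _ h2]
      rw [hs, H.conicSign_smul_conicPoint h2, complexQuadraticChar_div]
      have e3 (l t : F) : l * (a + 0 * t ^ 2 / 2 - 0 * t) = l * a := by ring
      simp_rw [e3, Finset.sum_const, Finset.card_univ, nsmul_eq_mul]
      simp_rw [mul_left_comm _ (Fintype.card F : ℂ)]
      rw [← Finset.mul_sum, sum_complexQuadraticChar_mul χ hF, zero_mul, MulChar.map_zero,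
        map_mul (complexQuadraticChar F) a 2]
      linear_combination -(Fintype.card F * complexQuadraticChar F a *
        gaussSum (complexQuadraticChar F) χ) * complexQuadraticChar_mul_self h2
    -- With b = 0 and c ≠ 0 the phase is linear and nonconstant in t for every l ≠ 0, so each inner
    -- sum vanishes.
    · rw [H.conicSign_of_notMem h2, zero_mul, MulChar.map_zero, zero_mul, zero_add, mul_zero]
      · refine Finset.sum_eq_zero fun l _ => ?_
        by_cases hl : l = 0
        · rw [hl, MulChar.map_zero, zero_mul]
        · have e3 (t : F) : χ (l * (a + 0 * t ^ 2 / 2 - c * t)) = χ (l * a) * χ (t * (-(l * c))) := by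
            rw [← AddChar.map_add_eq_mul]; congr 1; ring
          simp_rw [e3]
          rw [← Finset.mul_sum, sum_addChar_mul hχ, if_neg (by simp [hl, hc]), mul_zero, mul_zero]
      · rintro ⟨-, h⟩
        rw [H.trace_mul] at h
        have : c * c = 0 := by linear_combination -h
        exact hc (by simpa using this)
  -- Completing the square leaves the constant Tr(v²)/(2b). The resulting -η(2b)G cancels the
  -- contribution of the point at infinity, which is why its representative is 2x.
  · have e3 (l t : F) : l * (a + b * t ^ 2 / 2 - c * t) =
        l * (b / 2 * (t - c / b) ^ 2 + (a * b + b * a - c * c) / (2 * b)) := by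
      field_simp; ring
    simp_rw [e3]
    rw [sum_sum_addChar_quadratic hχ hF (div_ne_zero hb h2), complexQuadraticChar_div]
    by_cases hQ : a * b + b * a - c * c = 0
    · have hs : a • x + b • y + c • z = b • conicPoint x y z (some (c / b)) := by
        rw [smul_conicPoint_some]
        congr 3
        · field_simp
          linear_combination hQ
        · field_simp
      rw [hs, H.conicSign_smul_conicPoint h2, hQ, zero_div, if_pos rfl,
        map_mul (complexQuadraticChar F) b 2]
      ring
    · rw [H.conicSign_of_notMem h2, if_neg (div_ne_zero hQ (mul_ne_zero h2 hb))]
      · ring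
      · rintro ⟨-, h⟩
        rw [H.trace_mul] at h
        exact hQ h

end HyperbolicFrame

end Cone

/-! ### Counting residues in the fibres of a reduction. -/

section Counting

/-- As s is invertible modulo M, j ↦ k + sKj runs once through the residues modulo KM above k modulo
K. It is used with s = 1 for order 2N and with s = 4 for the Gauss periods. -/
theorem card_filter_cast_eq {L K M : ℕ} [NeZero L] (hL : L = K * M) {s : ℤ}
    (hs : IsCoprime s M) (X : Set (ZMod L)) [DecidablePred (· ∈ X)] (k : ℤ) :
    ∑ j ∈ Finset.range M, (if ((k + s * K * j : ℤ) : ZMod L) ∈ X then 1 else 0) =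
      (Finset.univ.filter fun x : ZMod L => x ∈ X ∧ (x.cast : ZMod K) = k).card := by
  have hK : K ∣ L := hL ▸ dvd_mul_right K M
  have hL0 : L ≠ 0 := NeZero.ne L
  have hK0 : (K : ℤ) ≠ 0 := by
    rintro h
    exact hL0 (by rw [hL, Nat.cast_eq_zero.1 h, zero_mul])
  have hM0 : M ≠ 0 := by
    rintro rfl
    exact hL0 (by rw [hL, mul_zero])
  have hLz : (L : ℤ) = K * M := by exact_mod_cast hL
  rw [← Finset.card_filter]
  refine Finset.card_bij (fun j _ => ((k + s * K * j : ℤ) : ZMod L)) ?_ ?_ ?_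
  · intro j hj
    rw [Finset.mem_filter] at hj ⊢
    refine ⟨Finset.mem_univ _, hj.2, ?_⟩
    rw [ZMod.cast_intCast hK]
    push_cast
    simp
  · intro i hi j hj h
    simp only [Finset.mem_filter, Finset.mem_range] at hi hj
    rw [ZMod.intCast_eq_intCast_iff_dvd_sub, hLz] at h
    have h1 : (K : ℤ) * M ∣ K * (s * (j - i)) := by
      convert h using 1; ring
    have h2 : (M : ℤ) ∣ j - i := hs.symm.dvd_of_dvd_mul_left ((mul_dvd_mul_iff_left hK0).1 h1)
    have h3 : (i : ℤ) ≡ j [ZMOD M] := Int.modEq_iff_dvd.2 h2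
    exact Nat.ModEq.eq_of_lt_of_lt (Int.natCast_modEq_iff.1 h3) hi.1 hj.1
  · intro x hx
    rw [Finset.mem_filter] at hx
    obtain ⟨-, hxX, hxk⟩ := hx
    obtain ⟨m, rfl⟩ := ZMod.intCast_surjective x
    rw [ZMod.cast_intCast hK, eq_comm, ZMod.intCast_eq_intCast_iff_dvd_sub] at hxk
    obtain ⟨t, ht⟩ := hxk
    obtain ⟨a, b, hab⟩ := hs
    have hM0' : (M : ℤ) ≠ 0 := by exact_mod_cast hM0
    have hnn := Int.emod_nonneg (t * a) hM0'
    have hlt := Int.emod_lt_of_pos (t * a) (by omega : (0 : ℤ) < M)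
    have hj : (((t * a % M).toNat : ℕ) : ℤ) = t * a % M := Int.toNat_of_nonneg hnn
    have heq : ((k + s * K * ((t * a % M).toNat : ℕ) : ℤ) : ZMod L) = (m : ZMod L) := by
      rw [ZMod.intCast_eq_intCast_iff_dvd_sub, hLz, hj]
      refine ⟨b * t + s * (t * a / M), ?_⟩
      have hd := Int.emod_add_mul_ediv (t * a) M
      linear_combination ht - (K : ℤ) * t * hab - s * K * hd
    refine ⟨(t * a % M).toNat, ?_, heq⟩
    rw [Finset.mem_filter, Finset.mem_range, heq]
    exact ⟨by omega, hxX⟩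

open Classical in
theorem count_reducedPart {n N M : ℕ} [NeZero n] (hn : n = N * M) (X : Set (ZMod (2 * n)))
    (J : Set (ZMod N)) (k : ℤ) :
    (reducedPart N X J).count (k : ZMod (2 * N)) = if (k : ZMod N) ∈ J then
      ∑ j ∈ Finset.range M, (if ((k + 2 * N * j : ℤ) : ZMod (2 * n)) ∈ X then 1 else 0) else 0 := by
  have h := card_filter_cast_eq (L := 2 * n) (K := 2 * N) (M := M) (by rw [hn]; ring)
    (s := 1) isCoprime_one_left X k
  have hN : N ∣ 2 * N := dvd_mul_left N 2
  have h2N : 2 * N ∣ 2 * n := mul_dvd_mul_left 2 ⟨M, hn⟩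
  have hc (x : ZMod (2 * n)) (hx : (x.cast : ZMod (2 * N)) = k) : (x.cast : ZMod N) = k := by
    obtain ⟨m, rfl⟩ := ZMod.intCast_surjective x
    rw [ZMod.cast_intCast h2N] at hx
    rw [ZMod.cast_intCast (hN.trans h2N), ← ZMod.cast_intCast hN m, hx, ZMod.cast_intCast hN]
  have h' : ∑ j ∈ Finset.range M, (if ((k + 2 * N * j : ℤ) : ZMod (2 * n)) ∈ X then 1 else 0) =
      (Finset.univ.filter fun x : ZMod (2 * n) => x ∈ X ∧ (x.cast : ZMod (2 * N)) = k).card := by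
    rw [← h]
    push_cast
    simp only [one_mul]
  rw [h', reducedPart, Multiset.count_map, ← Finset.filter_val, Finset.card_val, Finset.filter_filter]
  split_ifs with hJ
  · congr 1
    ext x
    simp only [Finset.mem_filter, Finset.mem_univ, true_and]
    constructor
    · rintro ⟨⟨hX, -⟩, h⟩
      exact ⟨hX, h.symm⟩
    · rintro ⟨hX, h⟩
      exact ⟨⟨hX, by rwa [hc x h]⟩, h.symm⟩
  · rw [Finset.card_eq_zero, Finset.filter_eq_empty_iff]
    rintro x - ⟨⟨-, hxJ⟩, h⟩
    rw [hc x h.symm] at hxJ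
    exact hJ hxJ

end Counting

/-! ### Cyclotomic classes and the subfield F inside ⟨ω⟩. -/

section Cyclotomic

variable {F E : Type*} [Field E] {ω : Eˣ}

theorem mem_iUnion_cyclotomicClass {K : ℕ} (hK : K ∣ orderOf ω) (I : Set (ZMod K)) (k : ℤ) :
    ((ω ^ k : Eˣ) : E) ∈ ⋃ ℓ ∈ I, cyclotomicClass ω K ℓ ↔ (k : ZMod K) ∈ I := by
  simp only [Set.mem_iUnion, cyclotomicClass]
  constructor
  · rintro ⟨ℓ, hℓ, m, rfl, h⟩
    rw [Units.val_inj, zpow_eq_zpow_iff_modEq] at h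
    rwa [(ZMod.intCast_eq_intCast_iff _ _ _).2 (h.of_dvd (Int.natCast_dvd_natCast.2 hK))]
  · intro h
    exact ⟨k, h, k, rfl, rfl⟩

theorem zero_notMem_iUnion_cyclotomicClass {K : ℕ} (I : Set (ZMod K)) :
    (0 : E) ∉ ⋃ ℓ ∈ I, cyclotomicClass ω K ℓ := by
  simp only [Set.mem_iUnion, cyclotomicClass]
  rintro ⟨ℓ, -, m, -, h⟩
  exact Units.ne_zero _ h.symm

variable [Fintype E]

open scoped Pointwise in
open Classical in
theorem charSum_smul (ψ : AddChar E ℂ) (a : Eˣ) (D : Set E) (hD : (0 : E) ∉ D) :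
    charSum ψ ((a : E) • D) = ∑ u : Eˣ, if (u : E) ∈ D then ψ (a * u) else 0 := by
  rw [charSum, ← Finset.sum_filter]
  symm
  refine Finset.sum_nbij (fun u : Eˣ => (a * u : E)) ?_ ?_ ?_ ?_
  · intro u hu
    rw [Finset.mem_filter] at hu ⊢
    exact ⟨Finset.mem_univ _, Set.smul_mem_smul_set hu.2⟩
  · intro u _ v _ h
    exact Units.ext (mul_left_cancel₀ a.ne_zero h)
  · intro v hv
    rw [Finset.mem_coe, Finset.mem_filter] at hv
    obtain ⟨w, hw, rfl⟩ := Set.mem_smul_set.1 hv.2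
    have hw0 : w ≠ 0 := fun h => hD (h ▸ hw)
    exact ⟨Units.mk0 w hw0, by simpa using hw, rfl⟩
  · intro u _
    rfl

open Classical in
theorem charSum_shiftedUnion (ψ : AddChar E ℂ) (K : ℕ) (c : ℤ) (I : Set (ZMod K)) :
    charSum ψ (shiftedUnion ω K c I) = ∑ u : Eˣ,
      if (u : E) ∈ ⋃ ℓ ∈ I, cyclotomicClass ω K ℓ then ψ ((ω ^ c : Eˣ) * u) else 0 :=
  charSum_smul ψ _ _ (zero_notMem_iUnion_cyclotomicClass I)

variable [Field F] [Fintype F] [Algebra F E]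
  (hE : Module.finrank F E = 3) (hω : ∀ x : Eˣ, x ∈ Subgroup.zpowers ω)
include hE hω

theorem orderOf_generator :
    orderOf ω = (Fintype.card F - 1) * (Fintype.card F ^ 2 + Fintype.card F + 1) := by
  classical
  rw [orderOf_eq_card_of_forall_mem_zpowers hω, Nat.card_eq_fintype_card, Fintype.card_units,
    Module.card_eq_pow_finrank (K := F), hE]
  obtain ⟨m, hm⟩ : ∃ m, Fintype.card F = m + 1 := ⟨_, (Nat.succ_pred Fintype.card_ne_zero).symm⟩
  rw [hm, Nat.add_sub_cancel]
  exact Nat.sub_eq_of_eq_add (by ring)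

theorem zpow_mem_range_algebraMap (k : ℤ) :
    ((ω ^ k : Eˣ) : E) ∈ Set.range (algebraMap F E) ↔
      ((Fintype.card F ^ 2 + Fintype.card F + 1 : ℕ) : ℤ) ∣ k := by
  have hq : 1 < Fintype.card F := Fintype.one_lt_card
  rw [mem_range_algebraMap_iff_pow_card_eq, ← Units.val_pow_eq_pow_val, Units.val_inj,
    ← zpow_natCast, ← zpow_mul, zpow_eq_zpow_iff_modEq, orderOf_generator hE hω, Int.modEq_comm,
    Int.modEq_iff_dvd]
  have h : k * (Fintype.card F : ℤ) - k = ((Fintype.card F - 1 : ℕ) : ℤ) * k := by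
    rw [Nat.cast_sub hq.le]; push_cast; ring
  rw [h, Nat.cast_mul]
  exact mul_dvd_mul_iff_left (by simp; omega)

theorem two_mul_dvd_orderOf (hq : Odd (Fintype.card F)) :
    2 * (Fintype.card F ^ 2 + Fintype.card F + 1) ∣ orderOf ω := by
  rw [orderOf_generator hE hω]
  obtain ⟨m, hm⟩ := hq
  exact mul_dvd_mul_right ⟨m, by omega⟩ _

/-- Nonzero squares of the base field are the powers of `ω` with exponent divisible by
`2 (q² + q + 1)`. -/
theorem exists_sq_eq_zpow_iff (hq : Odd (Fintype.card F)) (k : ℤ) :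
    (∃ s : F, ((ω ^ k : Eˣ) : E) = algebraMap F E (s ^ 2)) ↔
      ((2 * (Fintype.card F ^ 2 + Fintype.card F + 1) : ℕ) : ℤ) ∣ k := by
  set n := Fintype.card F ^ 2 + Fintype.card F + 1
  constructor
  · rintro ⟨s, hs⟩
    have hs0 : algebraMap F E s ≠ 0 := by
      intro h
      rw [map_pow, h] at hs
      exact Units.ne_zero _ (hs.trans (by simp))
    obtain ⟨j, hj⟩ := hω (Units.mk0 _ hs0)
    have hj' : ((ω ^ j : Eˣ) : E) = algebraMap F E s := congrArg Units.val hj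
    obtain ⟨i, rfl⟩ := (zpow_mem_range_algebraMap hE hω j).1 ⟨s, hj'.symm⟩
    rw [map_pow, ← hj', ← Units.val_pow_eq_pow_val, Units.val_inj, ← zpow_natCast, ← zpow_mul,
      zpow_eq_zpow_iff_modEq] at hs
    -- As q - 1 is even, 2n divides the order of ω, so the congruence of exponents descends to
    -- modulus 2n.
    have h2 := hs.of_dvd (Int.natCast_dvd_natCast.2 (two_mul_dvd_orderOf hE hω hq))
    have h3 := Int.modEq_iff_dvd.1 h2
    have h4 : ((2 * n : ℕ) : ℤ) ∣ (n : ℤ) * i * (2 : ℕ) := ⟨i, by push_cast; ring⟩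
    have h5 := dvd_sub h4 h3
    rwa [sub_sub_cancel] at h5
  · rintro ⟨i, rfl⟩
    obtain ⟨s, hs⟩ := (zpow_mem_range_algebraMap (F := F) hE hω ((n : ℤ) * i)).2 ⟨i, rfl⟩
    refine ⟨s, ?_⟩
    rw [map_pow, hs, ← Units.val_pow_eq_pow_val, ← zpow_natCast, ← zpow_mul]
    congr 2
    push_cast; ring

end Cyclotomic

/-! ### Discrete logarithms of the half cone. -/

section Lift

variable {F E : Type*} [Field E] {ω : Eˣ} [Field F] [Algebra F E]

theorem mem_isotropicCone_smul {g : F} (hg : g ≠ 0) {v : E} :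
    g • v ∈ isotropicCone F E ↔ v ∈ isotropicCone F E := by
  simp only [isotropicCone, Set.mem_ofPred_eq, smul_mul_smul_comm, map_smul, smul_eq_mul,
    mul_eq_zero, smul_eq_zero, hg, or_self, false_or, ne_eq]

theorem coe_zpow_mem_isotropicCone (k : ℤ) : ((ω ^ k : Eˣ) : E) ∈ isotropicCone F E ↔
    conicForm F ((ω ^ k : Eˣ) : E) = 0 := by
  rw [isotropicCone, Set.mem_ofPred_eq, conicForm, sq]
  exact and_iff_right (Units.ne_zero _)

variable [Fintype F] [Fintype E]
  (hE : Module.finrank F E = 3) (hω : ∀ x : Eˣ, x ∈ Subgroup.zpowers ω)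
include hE hω

/-- Exponents congruent modulo `q² + q + 1` give vectors that are proportional over `F`. -/
theorem exists_zpow_eq_smul {k m : ℤ}
    (h : (k : ZMod (Fintype.card F ^ 2 + Fintype.card F + 1)) = m) :
    ∃ g : F, g ≠ 0 ∧ ((ω ^ m : Eˣ) : E) = g • ((ω ^ k : Eˣ) : E) := by
  rw [ZMod.intCast_eq_intCast_iff_dvd_sub] at h
  obtain ⟨g, hg⟩ := (zpow_mem_range_algebraMap (F := F) hE hω (m - k)).2 h
  refine ⟨g, ?_, ?_⟩
  · rintro rfl
    exact Units.ne_zero _ (hg.symm.trans (map_zero _))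
  · rw [Algebra.smul_def, hg, ← Units.val_mul, ← zpow_add, sub_add_cancel]

theorem intCast_eq_of_zpow_eq_smul {k m : ℤ} {g : F}
    (h : ((ω ^ m : Eˣ) : E) = g • ((ω ^ k : Eˣ) : E)) :
    (k : ZMod (Fintype.card F ^ 2 + Fintype.card F + 1)) = m := by
  rw [ZMod.intCast_eq_intCast_iff_dvd_sub]
  refine (zpow_mem_range_algebraMap (F := F) hE hω (m - k)).1 ⟨g, ?_⟩
  rw [Algebra.smul_def] at h
  rw [zpow_sub, Units.val_mul, h, mul_assoc, ← Units.val_mul, mul_inv_cancel, Units.val_one,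
    mul_one]

theorem intCast_mem_conicIndices (k : ℤ) :
    (k : ZMod (Fintype.card F ^ 2 + Fintype.card F + 1)) ∈ conicIndices F ω _ ↔
      ((ω ^ k : Eˣ) : E) ∈ isotropicCone F E := by
  constructor
  · rintro ⟨m, hm, h⟩
    obtain ⟨g, hg, hgk⟩ := exists_zpow_eq_smul hE hω hm
    rw [hgk, mem_isotropicCone_smul hg, coe_zpow_mem_isotropicCone]
    exact h
  · intro h
    exact ⟨k, rfl, (coe_zpow_mem_isotropicCone k).1 h⟩

/-- An exponent modulo 2n fixes a vector up to nonzero squares of F. Affine representatives pair to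
1 with x, so the lift of l • P is l² • P and the integer chosen for each d ≠ d₀ is immaterial. -/
theorem mem_conicPartitionSet_iff (hq : Odd (Fintype.card F)) (h2 : (2 : F) ≠ 0)
    {r : ZMod (Fintype.card F ^ 2 + Fintype.card F + 1) → ℤ} (hr : ∀ i, (r i : ZMod _) = i)
    {d₀ : ZMod (Fintype.card F ^ 2 + Fintype.card F + 1)} {y z : E}
    (H : HyperbolicFrame F ((ω ^ r d₀ : Eˣ) : E) y z) (k : ℤ) :
    (k : ZMod (2 * (Fintype.card F ^ 2 + Fintype.card F + 1))) ∈ conicPartitionSet F ω _ r d₀ ↔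
      ((ω ^ k : Eˣ) : E) ∈ conicCone F ((ω ^ r d₀ : Eˣ) : E) y z := by
  set x : E := ((ω ^ r d₀ : Eˣ) : E) with hx
  have hnone : (2 : E) * x = conicPoint x y z (none : Option F) := by
    rw [conicPoint, Algebra.smul_def, map_ofNat]
  have hmain (l : F) (hl : l ≠ 0) (t : F) :
      l • conicPoint x y z (some t) * algebraMap F E (Algebra.trace F E
        (x * l • conicPoint x y z (some t))) = l ^ 2 • conicPoint x y z (some t) := by
    have ht : Algebra.trace F E (x * l • conicPoint x y z (some t)) = l := by
      rw [smul_conicPoint_some, H.trace_x_mul]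
    rw [ht, mul_comm, ← Algebra.smul_def, smul_smul, sq]
  constructor
  · rintro ⟨k', hk', hlift⟩
    rw [ZMod.intCast_eq_intCast_iff_dvd_sub] at hk'
    obtain ⟨s, hs⟩ := (exists_sq_eq_zpow_iff hE hω hq (k - k')).2 hk'
    have hs0 : s ≠ 0 := by
      rintro rfl
      exact Units.ne_zero _ (hs.trans (by simp))
    have hk : ((ω ^ k : Eˣ) : E) = s ^ 2 • ((ω ^ k' : Eˣ) : E) := by
      rw [Algebra.smul_def, ← hs, ← Units.val_mul, ← zpow_add, sub_add_cancel]
    rcases hlift with ⟨d, hd, hdd, h⟩ | h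
    · rw [zpow_add, Units.val_mul, ← hx] at h
      have hiso : ((ω ^ r d : Eˣ) : E) ∈ isotropicCone F E :=
        (intCast_mem_conicIndices hE hω (r d)).1 (by rwa [hr])
      obtain ⟨l, hl, o, ho⟩ := H.exists_smul_conicPoint h2 hiso
      rcases o with _ | t
      · refine absurd ?_ hdd
        rw [conicPoint, smul_smul] at ho
        have := intCast_eq_of_zpow_eq_smul hE hω ho
        rw [hr, hr] at this
        exact this.symm
      · rw [ho, hmain l hl] at h
        refine ⟨s * l, mul_ne_zero hs0 hl, some t, ?_⟩
        rw [hk, h, smul_smul, mul_pow]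
    · rw [Set.mem_singleton_iff, ← hx, hnone] at h
      exact ⟨s, hs0, none, by rw [hk, h]⟩
  · rintro ⟨s, hs, o, ho⟩
    suffices h : ∃ v ∈ conicLift F ω _ r d₀, ∃ l : F, l ≠ 0 ∧ ((ω ^ k : Eˣ) : E) = l ^ 2 • v by
      obtain ⟨v, hv, l, hl, hk⟩ := h
      have hv0 : v ≠ 0 := by
        rintro rfl
        exact Units.ne_zero _ (hk.trans (smul_zero _))
      obtain ⟨m, hm⟩ := hω (Units.mk0 v hv0)
      have hm' : ((ω ^ m : Eˣ) : E) = v := congrArg Units.val hm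
      refine ⟨m, ?_, by rwa [hm']⟩
      rw [ZMod.intCast_eq_intCast_iff_dvd_sub]
      refine (exists_sq_eq_zpow_iff (F := F) hE hω hq _).1 ⟨l, ?_⟩
      rw [zpow_sub, Units.val_mul, hk, ← hm', Algebra.smul_def, mul_assoc, ← Units.val_mul,
        mul_inv_cancel, Units.val_one, mul_one]
    rcases o with _ | t
    · exact ⟨_, Or.inr rfl, s, hs, by rw [ho, ← hx, hnone]⟩
    · have hP := H.smul_conicPoint_mem_isotropicCone h2 one_ne_zero (some t)
      rw [one_smul] at hP
      obtain ⟨m, hm⟩ := hω (Units.mk0 _ hP.1)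
      have hm' : ((ω ^ m : Eˣ) : E) = conicPoint x y z (some t) := congrArg Units.val hm
      obtain ⟨l, hl, hl'⟩ := exists_zpow_eq_smul hE hω
        (hr (m : ZMod (Fintype.card F ^ 2 + Fintype.card F + 1))).symm
      rw [hm'] at hl'
      refine ⟨_, Or.inl ⟨m, ?_, ?_, rfl⟩, s / l, div_ne_zero hs hl, ?_⟩
      · rw [intCast_mem_conicIndices hE hω, hm']
        exact hP
      · intro hmd
        rw [← hr d₀] at hmd
        obtain ⟨g, hg, hg'⟩ := exists_zpow_eq_smul hE hω hmd
        have hxg : x = g • conicPoint x y z (some t) := hx.trans (hg'.trans (by rw [hm']))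
        have h1 : Algebra.trace F E (x * x) = g := by
          refine (congrArg (fun v => Algebra.trace F E (x * v)) hxg).trans ?_
          rw [smul_conicPoint_some, H.trace_x_mul]
        exact hg (h1.symm.trans H.xx)
      · rw [zpow_add, Units.val_mul, ← hx, hl', hmain l hl, smul_smul, ho, div_pow,
          div_mul_cancel₀ _ (pow_ne_zero 2 hl)]

open Classical in
/-- Multiplication by `ω ^ (q² + q + 1)`, a nonsquare of `F`, exchanges the two halves of the
isotropic cone. -/
theorem ite_conicCone_add (hq : Odd (Fintype.card F)) (h2 : (2 : F) ≠ 0) {x y z : E}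
    (H : HyperbolicFrame F x y z) (k : ℤ) :
    ((if ((ω ^ k : Eˣ) : E) ∈ conicCone F x y z then 1 else 0) +
      if ((ω ^ (k + (Fintype.card F ^ 2 + Fintype.card F + 1 : ℕ)) : Eˣ) : E) ∈
        conicCone F x y z then 1 else 0) =
      if ((ω ^ k : Eˣ) : E) ∈ isotropicCone F E then 1 else 0 := by
  set n := Fintype.card F ^ 2 + Fintype.card F + 1 with hn
  obtain ⟨g, hg⟩ := (zpow_mem_range_algebraMap (F := F) hE hω (n : ℤ)).2 dvd_rfl
  have hg0 : g ≠ 0 := by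
    rintro rfl
    exact Units.ne_zero _ (hg.symm.trans (map_zero _))
  have hgs : ¬ IsSquare g := by
    rintro ⟨s, rfl⟩
    have h := (exists_sq_eq_zpow_iff (F := F) hE hω hq (n : ℤ)).1 ⟨s, by rw [← hg, sq]⟩
    rw [← hn, Int.natCast_dvd_natCast] at h
    have := Nat.le_of_dvd (by positivity) h
    omega
  have hkn : ((ω ^ (k + n) : Eˣ) : E) = g • ((ω ^ k : Eˣ) : E) := by
    rw [Algebra.smul_def, hg, ← Units.val_mul, ← zpow_add, add_comm]
  rw [hkn]
  by_cases hv : ((ω ^ k : Eˣ) : E) ∈ isotropicCone F E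
  · rw [if_pos hv]
    obtain ⟨l, hl, o, ho⟩ := H.exists_smul_conicPoint h2 hv
    -- The generator power g = ω ^ n is a nonsquare of F, so exactly one of l and g l is a square.
    have hgl : IsSquare (g * l) ↔ ¬ IsSquare l := by
      rw [← quadraticChar_one_iff_isSquare (mul_ne_zero hg0 hl),
        ← quadraticChar_neg_one_iff_not_isSquare, map_mul,
        quadraticChar_neg_one_iff_not_isSquare.2 hgs]
      omega
    rw [ho, smul_smul, H.smul_conicPoint_mem_conicCone h2 hl,
      H.smul_conicPoint_mem_conicCone h2 (mul_ne_zero hg0 hl), hgl]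
    by_cases hs : IsSquare l <;> simp [hs]
  · rw [if_neg hv, if_neg fun h => hv (H.conicCone_subset h2 h), if_neg fun h => hv ?_]
    exact (mem_isotropicCone_smul hg0).1 (H.conicCone_subset h2 h)

end Lift

/-! ### Gauss periods as intersection numbers with the conic. -/

section Periods

variable {F E : Type*} [Field E] {ω : Eˣ} [Field F] [Algebra F E] [Fintype F] [Fintype E]
  (hE : Module.finrank F E = 3) (hω : ∀ x : Eˣ, x ∈ Subgroup.zpowers ω)
include hE hω

open Classical in
/-- The sum of a trace character over the `F`-line through `ω ^ k`, without the origin. -/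
theorem sum_units_addChar_line {χ : AddChar F ℂ} (hχ : χ.IsPrimitive) (k : ℤ) :
    ∑ u : Eˣ, (if (u : E) ∈ ⋃ ℓ ∈ ({(k : ZMod (Fintype.card F ^ 2 + Fintype.card F + 1))} : Set _),
        cyclotomicClass ω _ ℓ then χ (Algebra.trace F E u) else 0) =
      (if Algebra.trace F E ((ω ^ k : Eˣ) : E) = 0 then (Fintype.card F : ℂ) else 0) - 1 := by
  have hd : Fintype.card F ^ 2 + Fintype.card F + 1 ∣ orderOf ω :=
    orderOf_generator hE hω ▸ dvd_mul_left _ _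
  rw [← sum_addChar_mul hχ, Fintype.sum_eq_add_sum_compl (0 : F), zero_mul,
    AddChar.map_zero_eq_one, add_sub_cancel_left, ← Finset.sum_filter]
  symm
  have hl0 {l : F} (hl : l ∈ ({0}ᶜ : Finset F)) : l ≠ 0 := by simpa using hl
  refine Finset.sum_bij (fun l hl =>
    Units.mk0 (l • ((ω ^ k : Eˣ) : E)) (smul_ne_zero (hl0 hl) (Units.ne_zero _))) ?_ ?_ ?_ ?_
  · intro l hl
    rw [Finset.mem_filter]
    refine ⟨Finset.mem_univ _, ?_⟩
    obtain ⟨m, hm⟩ := hω (Units.mk0 (l • ((ω ^ k : Eˣ) : E))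
      (smul_ne_zero (hl0 hl) (Units.ne_zero _)))
    have hm' : ((ω ^ m : Eˣ) : E) = l • ((ω ^ k : Eˣ) : E) := congrArg Units.val hm
    rw [Units.val_mk0, ← hm', mem_iUnion_cyclotomicClass hd, Set.mem_singleton_iff]
    exact (intCast_eq_of_zpow_eq_smul hE hω hm').symm
  · intro l _ l' _ h
    exact smul_left_injective F (Units.ne_zero (ω ^ k)) (congrArg Units.val h)
  · intro u hu
    obtain ⟨m, rfl⟩ := hω u
    rw [Finset.mem_filter, mem_iUnion_cyclotomicClass hd, Set.mem_singleton_iff] at hu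
    obtain ⟨g, hg, h⟩ := exists_zpow_eq_smul hE hω hu.2.symm
    exact ⟨g, by simpa using hg, Units.ext h.symm⟩
  · intro l _
    rw [Units.val_mk0, map_smul, smul_eq_mul]

-- A class of order N splits into M punctured F-lines, each summing to q - 1 or -1 according to
-- whether its trace vanishes. Indexing them by 2k + 4Nj, legitimate since M is odd, makes every
-- representative the square of ω ^ (k + 2Nj), so the trace condition becomes isotropy.
open scoped Pointwise in
open Classical in
theorem gaussPeriod_eq {χ : AddChar F ℂ} (hχ : χ.IsPrimitive) {ψ : AddChar E ℂ}
    (hψ : ∀ v, ψ v = χ (Algebra.trace F E v)) {M N : ℕ}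
    (hMN : M * N = Fintype.card F ^ 2 + Fintype.card F + 1) (k : ℤ) :
    gaussPeriod ψ ω N (2 * k : ZMod N) = Fintype.card F *
      (∑ j ∈ Finset.range M, if ((ω ^ (k + 2 * N * j) : Eˣ) : E) ∈ isotropicCone F E
        then 1 else 0 : ℕ) - M := by
  have hn : NeZero (Fintype.card F ^ 2 + Fintype.card F + 1) := ⟨by omega⟩
  have hNn : N ∣ Fintype.card F ^ 2 + Fintype.card F + 1 := ⟨M, by rw [← hMN, mul_comm]⟩
  have hd : Fintype.card F ^ 2 + Fintype.card F + 1 ∣ orderOf ω :=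
    orderOf_generator hE hω ▸ dvd_mul_left _ _
  have hodd : Odd (Fintype.card F ^ 2 + Fintype.card F + 1) := by
    rw [Nat.odd_add_one, Nat.not_odd_iff_even, sq, ← Nat.mul_succ]
    exact Nat.even_mul_succ_self _
  have hM : Odd M := Nat.Odd.of_mul_left (hMN ▸ hodd)
  have hcop : IsCoprime (4 : ℤ) M := by
    have h : Nat.Coprime (2 ^ 2) M := Nat.Coprime.pow_left 2 (Nat.coprime_two_left.2 hM)
    exact_mod_cast Nat.isCoprime_iff_coprime.2 h
  have hset : cyclotomicClass ω N (2 * k : ZMod N) = ((1 : Eˣ) : E) •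
      ⋃ ℓ ∈ ({((2 * k : ℤ) : ZMod N)} : Set (ZMod N)), cyclotomicClass ω N ℓ := by
    rw [Units.val_one, one_smul, Set.biUnion_singleton]
    push_cast
    rfl
  have hterm (u : Eˣ) : (if (u : E) ∈ ⋃ ℓ ∈ ({((2 * k : ℤ) : ZMod N)} : Set (ZMod N)),
      cyclotomicClass ω N ℓ then ψ ((1 : Eˣ) * u) else 0) =
      ∑ j ∈ Finset.range M, if (u : E) ∈ ⋃ ℓ ∈ ({((2 * k + 4 * N * j : ℤ) :
        ZMod (Fintype.card F ^ 2 + Fintype.card F + 1))} : Set _), cyclotomicClass ω _ ℓ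
        then χ (Algebra.trace F E u) else 0 := by
    obtain ⟨m, rfl : ω ^ m = u⟩ := hω u
    have hc := card_filter_cast_eq (L := Fintype.card F ^ 2 + Fintype.card F + 1) (K := N) (M := M)
      (by rw [← hMN, mul_comm]) hcop {(m : ZMod _)} (2 * k)
    simp_rw [mem_iUnion_cyclotomicClass hd, mem_iUnion_cyclotomicClass (hNn.trans hd)]
    simp only [Units.val_one, one_mul, hψ, Set.mem_singleton_iff] at hc ⊢
    rw [← Finset.sum_filter, Finset.sum_const, nsmul_eq_mul]
    rw [← Finset.card_filter] at hc
    simp_rw [@eq_comm _ (m : ZMod (Fintype.card F ^ 2 + Fintype.card F + 1))]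
    rw [hc]
    by_cases h : (m : ZMod N) = ((2 * k : ℤ) : ZMod N)
    · rw [if_pos h, Finset.card_eq_one.2 ⟨(m : ZMod _), ?_⟩]
      · simp
      · ext v
        simp only [Finset.mem_filter, Finset.mem_univ, true_and, Finset.mem_singleton]
        refine ⟨fun hv => hv.1, fun hv => ⟨hv, ?_⟩⟩
        rw [hv, ZMod.cast_intCast hNn, h]
    · rw [if_neg h, Finset.card_eq_zero.2]
      · simp
      · rw [Finset.filter_eq_empty_iff]
        rintro v - ⟨rfl, hv⟩
        rw [ZMod.cast_intCast hNn] at hv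
        exact h hv
  rw [gaussPeriod, hset, charSum_smul ψ 1 _ (zero_notMem_iUnion_cyclotomicClass _),
    Finset.sum_congr rfl fun u _ => hterm u, Finset.sum_comm,
    Finset.sum_congr rfl fun (j : ℕ) _ => sum_units_addChar_line hE hω hχ (2 * k + 4 * N * j),
    Finset.sum_sub_distrib, Finset.sum_const, Finset.card_range, nsmul_eq_mul, mul_one,
    Nat.cast_sum, Finset.mul_sum]
  congr 1
  refine Finset.sum_congr rfl fun j _ => ?_
  have he : ((ω ^ (2 * k + 4 * N * j : ℤ) : Eˣ) : E) = ((ω ^ (k + 2 * N * j : ℤ) : Eˣ) : E) ^ 2 := by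
    rw [← Units.val_pow_eq_pow_val, ← zpow_natCast, ← zpow_mul]
    congr 2
    push_cast; ring
  rw [he, coe_zpow_mem_isotropicCone, conicForm]
  split_ifs <;> simp

end Periods

/-! ### Canonical characters, the cubic Gauss sum and averaging. -/

theorem canonicalAddChar_isPrimitive (p : ℕ) [Fact p.Prime] (E : Type*) [Field E] [Finite E]
    [Algebra (ZMod p) E] : (canonicalAddChar p E).IsPrimitive := by
  refine AddChar.IsPrimitive.of_ne_one ?_
  obtain ⟨a, ha⟩ := Algebra.trace_surjective (ZMod p) E 1
  rw [AddChar.ne_one_iff]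
  refine ⟨a, fun h => ?_⟩
  have h1 : ZMod.stdAddChar (1 : ZMod p) = ZMod.stdAddChar (0 : ZMod p) := by
    rw [AddChar.map_zero_eq_one, ← ha]
    exact h
  exact one_ne_zero (ZMod.injective_stdAddChar h1)

theorem exists_primitive_addChar_trace (p : ℕ) [Fact p.Prime] (F E : Type*) [Field F] [Finite F]
    [Field E] [Finite E] [Algebra F E] [Algebra (ZMod p) E] :
    ∃ χ : AddChar F ℂ, χ.IsPrimitive ∧
      ∀ v, canonicalAddChar p E v = χ (Algebra.trace F E v) := by
  have : CharP E p := charP_of_injective_algebraMap (algebraMap (ZMod p) E).injective p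
  have : CharP F p := (algebraMap F E).charP (algebraMap F E).injective p
  let _ : Algebra (ZMod p) F := ZMod.algebra F p
  have : IsScalarTower (ZMod p) F E := IsScalarTower.of_algebraMap_eq' (Subsingleton.elim _ _)
  have : FiniteDimensional F E := Module.Finite.of_finite
  refine ⟨canonicalAddChar p F, canonicalAddChar_isPrimitive p F, fun v => ?_⟩
  change ZMod.stdAddChar (Algebra.trace (ZMod p) E v) =
    ZMod.stdAddChar (Algebra.trace (ZMod p) F (Algebra.trace F E v))
  rw [Algebra.trace_trace]

/-- The quadratic Gauss sum of a cubic extension, up to sign, in terms of the base field. -/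
theorem gaussSum_cubic_sq {F E : Type*} [Field F] [Fintype F] [DecidableEq F] [Field E] [Fintype E]
    [DecidableEq E] [Algebra F E] (hE : Module.finrank F E = 3) (hF : ringChar F ≠ 2)
    {χ : AddChar F ℂ} (hχ : χ.IsPrimitive) {ψ : AddChar E ℂ} (hψ : ψ.IsPrimitive) :
    (Fintype.card F * complexQuadraticChar F 2 * gaussSum (complexQuadraticChar F) χ) ^ 2 =
      quadraticGaussSum ψ ^ 2 := by
  have h2 : (2 : F) ≠ 0 := Ring.two_ne_zero hF
  have hF' : ringChar E ≠ 2 := by rwa [← Algebra.ringChar_eq F E]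
  -- The values are χ₄(q³) and χ₄(q), which agree because cubing fixes 0, 1 and -1.
  have hneg : complexQuadraticChar E (-1) = complexQuadraticChar F (-1) := by
    rw [complexQuadraticChar_apply, complexQuadraticChar_apply, quadraticChar_neg_one hF,
      quadraticChar_neg_one hF', Module.card_eq_pow_finrank (K := F) (V := E), hE, Nat.cast_pow,
      map_pow]
    rcases ZMod.isQuadratic_χ₄ (Fintype.card F : ZMod 4) with h | h | h <;> rw [h] <;> norm_num
  rw [mul_pow, mul_pow, gaussSum_sq (complexQuadraticChar_ne_one hF)
    complexQuadraticChar_isQuadratic hχ]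
  change _ = gaussSum (complexQuadraticChar E) ψ ^ 2
  rw [gaussSum_sq (complexQuadraticChar_ne_one hF') complexQuadraticChar_isQuadratic hψ, hneg,
    sq (complexQuadraticChar F 2), complexQuadraticChar_mul_self h2,
    Module.card_eq_pow_finrank (K := F) (V := E), hE]
  push_cast
  ring

theorem mem_half_iff {N : ℕ} (hN : Odd N) (I : Set (ZMod N)) (i : ZMod N) :
    i ∈ half I ↔ 2 * i ∈ I := by
  have h : (2 : ZMod N) * 2⁻¹ = 1 := by
    exact_mod_cast ZMod.coe_mul_inv_eq_one 2 (Nat.coprime_two_left.2 hN)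
  constructor
  · rintro ⟨j, hj, rfl⟩
    simpa only [← mul_assoc, h, one_mul] using hj
  · intro hi
    refine ⟨2 * i, hi, ?_⟩
    change (2 : ZMod N)⁻¹ * (2 * i) = i
    rw [← mul_assoc, mul_comm _ 2, h, one_mul]

open Classical in
/-- Averages of an eigenfunction of the Fourier transform over translates. -/
theorem sum_translates {E : Type*} [Field E] [Fintype E] {ω : Eˣ} {f : E → ℂ} {ψ : AddChar E ℂ}
    {κ : ℂ} (hf0 : f 0 = 0) (hf : ∀ v, ∑ u, f u * ψ (v * u) = κ * f v) (s c : ℤ) (M : ℕ) :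
    ∑ u : Eˣ, (∑ j ∈ Finset.range M, f ((ω ^ (s * j) : Eˣ) * u)) * ψ ((ω ^ c : Eˣ) * u) =
      κ * ∑ j ∈ Finset.range M, f ((ω ^ (c - s * (M - 1) + s * j) : Eˣ) : E) := by
  have hunits (v : E) : ∑ u : Eˣ, f u * ψ (v * u) = κ * f v := by
    rw [← hf v]
    refine Finset.sum_of_injOn Units.val (fun _ _ _ _ h => Units.ext h) (fun _ _ => by simp) ?_
      fun _ _ => rfl
    intro u _ hu
    have : u = 0 := by
      by_contra h
      exact hu ⟨Units.mk0 u h, by simp, rfl⟩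
    rw [this, hf0, zero_mul]
  have hj (j : ℕ) : ∑ u : Eˣ, f ((ω ^ (s * j) : Eˣ) * u) * ψ ((ω ^ c : Eˣ) * u) =
      κ * f ((ω ^ (c - s * j) : Eˣ) : E) := by
    rw [← hunits]
    refine Fintype.sum_equiv (Equiv.mulLeft (ω ^ (s * j))) _ _ fun u => ?_
    rw [Equiv.coe_mulLeft, Units.val_mul]
    congr 2
    rw [← mul_assoc, ← Units.val_mul, ← Units.val_mul, ← zpow_add, sub_add_cancel, Units.val_mul]
  simp_rw [Finset.sum_mul]
  rw [Finset.sum_comm, Finset.sum_congr rfl fun j _ => hj j, ← Finset.mul_sum,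
    -- Translation by sj turns c into c - sj; reversing j restores increasing exponents, starting at
    -- c - s(M - 1).
    ← Finset.sum_range_reflect]
  congr 1
  refine Finset.sum_congr rfl fun j hj => ?_
  have hj' : j < M := Finset.mem_range.1 hj
  congr 3
  rw [Nat.sub_sub, Nat.cast_sub (by omega)]
  push_cast
  ring

end ConicPartition

/-! ### Assembly. -/

theorem mainTheorem3 (p q M N : ℕ) [Fact p.Prime]
    (F E : Type*) [Field F] [Fintype F] [Field E] [Fintype E] [DecidableEq E]
    [Algebra F E] [Algebra (ZMod p) E]
    (hF : Fintype.card F = q) (hq : Odd q) (hE : Module.finrank F E = 3)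
    (ω : Eˣ) (hω : ∀ x : Eˣ, x ∈ Subgroup.zpowers ω)
    (hMN : M * N = q ^ 2 + q + 1)
    (ψ : AddChar E ℂ) (hψ : ψ = ConicPartition.canonicalAddChar p E)
    (hperiods : Set.range (ConicPartition.gaussPeriod ψ ω N) =
      {-(M : ℂ) + 2 * q, -(M : ℂ) + q, -(M : ℂ)})
    (I₁ I₂ : Set (ZMod N))
    (hI₁ : I₁ = ConicPartition.periodIndices ψ ω N (-(M : ℂ) + 2 * q))
    (hI₂ : I₂ = ConicPartition.periodIndices ψ ω N (-(M : ℂ) + q))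
    (r : ZMod (q ^ 2 + q + 1) → ℤ) (hr : ∀ i, (r i : ZMod (q ^ 2 + q + 1)) = i)
    (d₀ : ZMod (q ^ 2 + q + 1)) (hd₀ : d₀ ∈ ConicPartition.conicIndices F ω (q ^ 2 + q + 1))
    (XQ : Set (ZMod (2 * (q ^ 2 + q + 1))))
    (hXQ : XQ = ConicPartition.conicPartitionSet F ω (q ^ 2 + q + 1) r d₀)
    (X₁ X₂ : Multiset (ZMod (2 * N)))
    (hX₁ : X₁ = ConicPartition.reducedPart N XQ (ConicPartition.half I₁))
    (hX₂ : X₂ = ConicPartition.reducedPart N XQ (ConicPartition.half I₂))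
    (hpure : ConicPartition.IsPurelySet X₁) (c : ℤ) :
    ((c : ZMod N) ∈ ConicPartition.half I₂ →
      2 * ConicPartition.charSum ψ (ConicPartition.shiftedUnion ω (2 * N) c {ℓ | ℓ ∈ X₂}) -
          ConicPartition.charSum ψ (ConicPartition.shiftedUnion ω N c (ConicPartition.half I₂)) =
        ConicPartition.quadraticGaussSum ψ ∨
      2 * ConicPartition.charSum ψ (ConicPartition.shiftedUnion ω (2 * N) c {ℓ | ℓ ∈ X₂}) -
          ConicPartition.charSum ψ (ConicPartition.shiftedUnion ω N c (ConicPartition.half I₂)) =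
        -ConicPartition.quadraticGaussSum ψ) ∧
    ((c : ZMod N) ∉ ConicPartition.half I₂ →
      2 * ConicPartition.charSum ψ (ConicPartition.shiftedUnion ω (2 * N) c {ℓ | ℓ ∈ X₂}) -
          ConicPartition.charSum ψ (ConicPartition.shiftedUnion ω N c (ConicPartition.half I₂)) =
        0) := by
  classical
  subst hF
  have hodd : Odd (Fintype.card F ^ 2 + Fintype.card F + 1) := by
    rw [Nat.odd_add_one, Nat.not_odd_iff_even, sq, ← Nat.mul_succ]
    exact Nat.even_mul_succ_self _
  have hN : Odd N := Nat.Odd.of_mul_right (hMN ▸ hodd)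
  have hM : Odd M := Nat.Odd.of_mul_left (hMN ▸ hodd)
  have hnNM : Fintype.card F ^ 2 + Fintype.card F + 1 = N * M := by rw [← hMN, mul_comm]
  have hF2 : ringChar F ≠ 2 := by
    intro h
    exact Nat.not_even_iff_odd.2 hq (Nat.even_iff.2 (FiniteField.even_card_of_char_two h))
  have h2 : (2 : F) ≠ 0 := Ring.two_ne_zero hF2
  have hd2n : 2 * (Fintype.card F ^ 2 + Fintype.card F + 1) ∣ orderOf ω := ConicPartition.two_mul_dvd_orderOf hE hω hq
  obtain ⟨χ, hχ, hψχ⟩ := ConicPartition.exists_primitive_addChar_trace p F E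
  rw [← hψ] at hψχ
  have hψp : ψ.IsPrimitive := hψ ▸ ConicPartition.canonicalAddChar_isPrimitive p E
  set x : E := ((ω ^ r d₀ : Eˣ) : E) with hx
  have hxi : x ∈ ConicPartition.isotropicCone F E :=
    (ConicPartition.intCast_mem_conicIndices hE hω (r d₀)).1 (by rwa [hr])
  obtain ⟨y, z, H⟩ := ConicPartition.exists_hyperbolicFrame F hE h2 hxi.1 hxi.2
  let a : ℤ → ℕ := fun k => ∑ j ∈ Finset.range M,
    if ((ω ^ (k + 2 * N * j) : Eˣ) : E) ∈ ConicPartition.conicCone F x y z then 1 else 0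
  let w : ℤ → ℕ := fun k => ∑ j ∈ Finset.range M,
    if ((ω ^ (k + 2 * N * j) : Eˣ) : E) ∈ ConicPartition.isotropicCone F E then 1 else 0
  have haX (k : ℤ) : a k = ∑ j ∈ Finset.range M,
      if ((k + 2 * N * j : ℤ) : ZMod (2 * (Fintype.card F ^ 2 + Fintype.card F + 1))) ∈ XQ then 1 else 0 := by
    refine Finset.sum_congr rfl fun j _ => ?_
    rw [hXQ, ConicPartition.mem_conicPartitionSet_iff hE hω hq h2 hr H]
  have hcount (J : Set (ZMod N)) (k : ℤ) : (ConicPartition.reducedPart N XQ J).count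
      (k : ZMod (2 * N)) = if (k : ZMod N) ∈ J then a k else 0 := by
    rw [ConicPartition.count_reducedPart hnNM, haX]
  have haper {k k' : ℤ} (h : (k : ZMod (2 * N)) = k') : a k = a k' := by
    have hc (k : ℤ) := ConicPartition.card_filter_cast_eq (L := 2 * (Fintype.card F ^ 2 + Fintype.card F + 1)) (K := 2 * N) (M := M)
      (by rw [hnNM]; ring) (s := 1) isCoprime_one_left XQ k
    push_cast at hc
    simp only [one_mul] at hc
    rw [haX, haX]
    push_cast
    rw [hc, hc, h]
  have hadd (k : ℤ) : a k + a (k + N) = w k := by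
    -- As M is odd, n = NM is congruent to N modulo 2N, the period of a.
    have h1 : a (k + N) = a (k + (Fintype.card F ^ 2 + Fintype.card F + 1 : ℕ)) := by
      apply haper
      rw [ZMod.intCast_eq_intCast_iff_dvd_sub, hnNM]
      obtain ⟨m, hm⟩ := hM
      exact ⟨m, by rw [hm]; push_cast; ring⟩
    rw [h1, ← Finset.sum_add_distrib]
    refine Finset.sum_congr rfl fun j _ => ?_
    rw [← ConicPartition.ite_conicCone_add hE hω hq h2 H, add_right_comm]
  have hper (k : ℤ) : ConicPartition.gaussPeriod ψ ω N (2 * k : ZMod N) = Fintype.card F * (w k : ℂ) - M :=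
    ConicPartition.gaussPeriod_eq hE hω hχ hψχ hMN k
  have hq0 : (Fintype.card F : ℂ) ≠ 0 := Nat.cast_ne_zero.2 Fintype.card_ne_zero
  have hper' (k : ℤ) (i : ℕ) : ConicPartition.gaussPeriod ψ ω N (2 * k : ZMod N) =
      -M + i * Fintype.card F ↔ w k = i := by
    rw [hper, ← Nat.cast_inj (R := ℂ)]
    constructor
    · intro h
      exact mul_left_cancel₀ hq0 (by linear_combination h)
    · intro h
      linear_combination (Fintype.card F : ℂ) * h
  have hw1 (k : ℤ) : (k : ZMod N) ∈ ConicPartition.half I₁ ↔ w k = 2 := by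
    rw [ConicPartition.mem_half_iff hN, hI₁, ← hper', Nat.cast_ofNat]
    rfl
  have hw2 (k : ℤ) : (k : ZMod N) ∈ ConicPartition.half I₂ ↔ w k = 1 := by
    rw [ConicPartition.mem_half_iff hN, hI₂, ← hper', Nat.cast_one, one_mul]
    rfl
  have hw (k : ℤ) : w k = 2 ∨ w k = 1 ∨ w k = 0 := by
    have h : ConicPartition.gaussPeriod ψ ω N (2 * k : ZMod N) ∈
      ({-(M : ℂ) + 2 * Fintype.card F, -(M : ℂ) + Fintype.card F, -(M : ℂ)} : Set ℂ) :=
        hperiods ▸ ⟨_, rfl⟩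
    rw [← hper', ← hper', ← hper']
    simpa using h
  have hX₂mem (k : ℤ) : (k : ZMod (2 * N)) ∈ X₂ ↔ w k = 1 ∧ a k ≠ 0 := by
    rw [← Multiset.count_ne_zero, hX₂, hcount]
    by_cases h : (k : ZMod N) ∈ ConicPartition.half I₂
    · rw [if_pos h]
      exact (and_iff_right ((hw2 k).1 h)).symm
    · rw [if_neg h]
      simp [← hw2, h]
  have hpure' (k : ℤ) (h : w k = 2) : a k ≤ 1 := by
    have h1 := hpure (k : ZMod (2 * N))
    rwa [hX₁, hcount, if_pos ((hw1 k).2 h)] at h1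
  have hwN (k : ℤ) : w (k + N) = w k := by
    rw [← hadd, ← hadd k, add_comm]
    congr 1
    apply haper
    push_cast
    rw [add_assoc, ← two_mul]
    have : ((2 * N : ℕ) : ZMod (2 * N)) = 0 := ZMod.natCast_self _
    push_cast at this
    rw [this, add_zero]
  have hchar (k : ℤ) : 2 * (a k : ℂ) - w k = 2 * (if (k : ZMod (2 * N)) ∈ X₂ then 1 else 0) -
      if (k : ZMod N) ∈ ConicPartition.half I₂ then 1 else 0 := by
    have hk := hadd k
    simp only [hX₂mem, hw2]
    rcases hw k with h | h | h
    -- Here a(k) and a(k + N) are at most 1 with sum 2, so both equal 1 and 2a - w = 0.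
    · have h1 := hpure' k h
      have h3 := hpure' (k + N) ((hwN k).trans h)
      have h4 : a k = 1 := by omega
      simp [h, h4]
    · have h1 : a k = 0 ∨ a k = 1 := by omega
      rcases h1 with h1 | h1 <;> simp [h, h1]
    · have h1 : a k = 0 := by omega
      simp [h, h1]
  set κ : ℂ := Fintype.card F * ConicPartition.complexQuadraticChar F 2 *
    gaussSum (ConicPartition.complexQuadraticChar F) χ with hκ
  have hκG : κ = ConicPartition.quadraticGaussSum ψ ∨ κ = -ConicPartition.quadraticGaussSum ψ :=
    sq_eq_sq_iff_eq_or_eq_neg.1 (ConicPartition.gaussSum_cubic_sq hE hF2 hχ hψp)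
  have hS (k : ℤ) : ∑ j ∈ Finset.range M,
      ConicPartition.conicSign F x y z ((ω ^ (k + 2 * N * j) : Eˣ) : E) = 2 * (a k : ℂ) - w k := by
    simp only [ConicPartition.conicSign, Finset.sum_sub_distrib, ← Finset.mul_sum]
    push_cast [a, w]
    rfl
  have hfinal : 2 * ConicPartition.charSum ψ
        (ConicPartition.shiftedUnion ω (2 * N) c {ℓ | ℓ ∈ X₂}) -
      ConicPartition.charSum ψ (ConicPartition.shiftedUnion ω N c (ConicPartition.half I₂)) =
      κ * (2 * (if (c : ZMod (2 * N)) ∈ X₂ then 1 else 0) -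
        if (c : ZMod N) ∈ ConicPartition.half I₂ then 1 else 0) := by
    have hd2N : 2 * N ∣ orderOf ω := (mul_dvd_mul_left 2 ⟨M, hnNM⟩).trans hd2n
    have hdN : N ∣ orderOf ω := (dvd_mul_left N 2).trans hd2N
    have ht := ConicPartition.sum_translates (ω := ω) (f := ConicPartition.conicSign F x y z)
      (ψ := ψ) (κ := κ) (H.conicSign_of_notMem h2 fun h => h.1 rfl)
      (fun v => by simp_rw [hψχ]; exact H.sum_conicSign_addChar h2 hF2 hχ v) (2 * N) c M
    rw [hS, hchar] at ht
    -- The shift left by the reversal is a multiple of 2N, invisible to both indicators.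
    have hc1 : ((c - 2 * N * (M - 1) : ℤ) : ZMod (2 * N)) = c := by
      rw [ZMod.intCast_eq_intCast_iff_dvd_sub]
      exact ⟨M - 1, by push_cast; ring⟩
    have hc2 : ((c - 2 * N * (M - 1) : ℤ) : ZMod N) = c := by
      rw [ZMod.intCast_eq_intCast_iff_dvd_sub]
      exact ⟨2 * (M - 1), by ring⟩
    rw [hc1, hc2] at ht
    rw [← ht, ConicPartition.charSum_shiftedUnion, ConicPartition.charSum_shiftedUnion,
      Finset.mul_sum, ← Finset.sum_sub_distrib]
    refine Finset.sum_congr rfl fun u _ => ?_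
    obtain ⟨m, rfl : ω ^ m = u⟩ := hω u
    have he (j : ℕ) : ((ω ^ (2 * N * j : ℤ) : Eˣ) : E) * ((ω ^ m : Eˣ) : E) =
        ((ω ^ (m + 2 * N * j : ℤ) : Eˣ) : E) := by
      rw [← Units.val_mul, ← zpow_add, add_comm]
    simp_rw [he]
    rw [hS, hchar]
    simp_rw [ConicPartition.mem_iUnion_cyclotomicClass hd2N,
      ConicPartition.mem_iUnion_cyclotomicClass hdN, Set.mem_ofPred_eq]
    split_ifs <;> ring
  rw [hfinal]
  constructor
  · intro hc
    rw [if_pos hc]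
    split_ifs
    · rcases hκG with h | h <;> rw [h]
      · left; ring
      · right; ring
    · rcases hκG with h | h <;> rw [h]
      · right; ring
      · left; ring
  · intro hc
    rw [if_neg hc, if_neg fun h => hc ((hw2 c).2 ((hX₂mem c).1 h).1)]
    ring
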